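/- Let $\mathbf{k}$ be an algebraically closed field and let $R=\mathbf{k}[x_0,x_1,y_0,y_1]$ be bigraded by $\deg x_i=(1,0)$, $\deg y_i=(0,1)$. Let $Z$ be a fat point scheme in $\mathbb{P}^1\times\mathbb{P}^1$, that is, a finite set $X=\{P_1,\dots,P_s\}$ of distinct points of $\mathbb{P}^1\times\mathbb{P}^1$ (the support) with multiplicities $m_1,\dots,m_s\ge 1$, and with defining ideal $I_Z=\bigcap_{h=1}^s\wp_h^{m_h}\subseteq R$, where $\wp_h=(a_1x_0-a_0x_1,\ b_1y_0-b_0y_1)$ if $P_h=[a_0:a_1]\times[b_0:b_1]$. Let $$H_Z(i,j)=\dim_{\mathbf{k}}\bigl(R_{i,j}/(R_{i,j}\cap I_Z)\bigr),\qquad (i,j)\in\mathbb{N}^2,$$ be its Hilbert function. Let $A_1,\dots,A_r$ be the distinct first coordinates and $B_1,\dots,B_t$ the distinct second coordinates of the points of $X$. Let $l_u$ be the maximum of the multiplicities of the points of $X$ with first coordinate $A_u$, and let $l'_v$ be the maximum of the multiplicities of the points of $X$ with second coordinate $B_v$. Put $m=l_1+\cdots+l_r$ and $m'=l'_1+\cdots+l'_t$.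 Then for all $(i,j)\in\mathbb{N}^2$: 1. if $i\ge m-1$ and $j\ge m'-1$, then $H_Z(i,j)=\sum_{h=1}^s\binom{m_h+1}{2}$; 2. if $i\ge m-1$, then $H_Z(i,j)=H_Z(m-1,j)$; 3. if $j\ge m'-1$, then $H_Z(i,j)=H_Z(i,m'-1)$. (If $X=\emptyset$, so that $I_Z=R$ and $m=m'=0$, the numbers $m-1$ and $m'-1$ are read as $0$.) -/

import Mathlib

noncomputable section

namespace FatPoints

open MvPolynomial

/-- The projective line over `k`. -/
abbrev P1 (k : Type*) [Field k] := Projectivization k (Fin 2 → k)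

/-- The coordinate ring `k[x₀, x₁, y₀, y₁]` of `ℙ¹ × ℙ¹`; the variables `Sum.inl 0`, `Sum.inl 1`
are `x₀`, `x₁`, and `Sum.inr 0`, `Sum.inr 1` are `y₀`, `y₁`. -/
abbrev CoordRing (k : Type*) [Field k] := MvPolynomial (Fin 2 ⊕ Fin 2) k

/-- The bigrading: `deg xᵢ = (1, 0)` and `deg yᵢ = (0, 1)`. -/
def bidegree : Fin 2 ⊕ Fin 2 → ℕ × ℕ :=
  Sum.elim (fun _ => (1, 0)) (fun _ => (0, 1))

/-- The space `R_{i,j}` of bihomogeneous polynomials of degree `(i, j)`. -/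
def bigraded (k : Type*) [Field k] (i j : ℕ) : Submodule k (CoordRing k) :=
  weightedHomogeneousSubmodule k bidegree (i, j)

/-- The `(1, 0)`-form `a₁ x₀ - a₀ x₁`. -/
def formX {k : Type*} [Field k] (a : Fin 2 → k) : CoordRing k :=
  C (a 1) * X (Sum.inl 0) - C (a 0) * X (Sum.inl 1)

/-- The `(0, 1)`-form `b₁ y₀ - b₀ y₁`. -/
def formY {k : Type*} [Field k] (b : Fin 2 → k) : CoordRing k :=
  C (b 1) * X (Sum.inr 0) - C (b 0) * X (Sum.inr 1)

/-- The ideal `(a₁ x₀ - a₀ x₁, b₁ y₀ - b₀ y₁)` of the point `[a₀ : a₁] × [b₀ : b₁]`; by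
`pointIdeal_mk` it does not depend on the chosen homogeneous coordinates. -/
def pointIdeal {k : Type*} [Field k] (P : P1 k × P1 k) : Ideal (CoordRing k) :=
  Ideal.span {formX P.1.rep, formY P.2.rep}

/-- A fat point scheme in `ℙ¹ × ℙ¹`, given by the finitely supported function that sends a point
to its multiplicity: `Z.support` is the support, and the multiplicity `Z P` is positive exactly at
the points `P` of the support. -/
abbrev FatPointScheme (k : Type*) [Field k] := (P1 k × P1 k) →₀ ℕ

/-- The defining ideal `I_Z = ⋂ ℘_P ^ m_P`. -/
def ideal {k : Type*} [Field k] (Z : FatPointScheme k) : Ideal (CoordRing k) :=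
  ⨅ P ∈ Z.support, pointIdeal P ^ Z P

/-- The Hilbert function `(i, j) ↦ dim_k R_{i,j} / I_{i,j}` of `R / I`, with
`I_{i,j} = R_{i,j} ∩ I`. -/
def hilbert {k : Type*} [Field k] (I : Ideal (CoordRing k)) (i j : ℕ) : ℕ :=
  Module.finrank k
    (bigraded k i j ⧸ (I.restrictScalars k).submoduleOf (bigraded k i j))

/-- The Hilbert function `H_Z` of `Z`. -/
def hilbertFn {k : Type*} [Field k] (Z : FatPointScheme k) (i j : ℕ) : ℕ :=
  hilbert (ideal Z) i j

open Classical in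
/-- For a first coordinate `A`, the maximal multiplicity of a point `A × B` of the support. -/
def maxMult₁ {k : Type*} [Field k] (Z : FatPointScheme k) (A : P1 k) : ℕ :=
  (Z.support.filter (fun P => P.1 = A)).sup (fun P => Z P)

open Classical in
/-- For a second coordinate `B`, the maximal multiplicity of a point `A × B` of the support. -/
def maxMult₂ {k : Type*} [Field k] (Z : FatPointScheme k) (B : P1 k) : ℕ :=
  (Z.support.filter (fun P => P.2 = B)).sup (fun P => Z P)

open Classical in
/-- `m = l₁ + ⋯ + l_r`, the sum of `maxMult₁` over the distinct first coordinates of the support. -/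
def sumMax₁ {k : Type*} [Field k] (Z : FatPointScheme k) : ℕ :=
  ∑ A ∈ Z.support.image Prod.fst, maxMult₁ Z A

open Classical in
/-- `m' = l'₁ + ⋯ + l'_t`, the sum of `maxMult₂` over the distinct second coordinates of the
support. -/
def sumMax₂ {k : Type*} [Field k] (Z : FatPointScheme k) : ℕ :=
  ∑ B ∈ Z.support.image Prod.snd, maxMult₂ Z B

theorem pointIdeal_mk {k : Type*} [Field k] (a b : Fin 2 → k) (ha : a ≠ 0) (hb : b ≠ 0) :
    pointIdeal (Projectivization.mk k a ha, Projectivization.mk k b hb) =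
      Ideal.span {formX a, formY b} := by
  obtain ⟨u, hu⟩ := Projectivization.exists_smul_eq_mk_rep k a ha
  obtain ⟨v, hv⟩ := Projectivization.exists_smul_eq_mk_rep k b hb
  have hx : formX (u • a) = formX a * C (u : k) := by
    simp only [formX, Pi.smul_apply, Units.smul_def, smul_eq_mul, C_mul]; ring
  have hy : formY (v • b) = formY b * C (v : k) := by
    simp only [formY, Pi.smul_apply, Units.smul_def, smul_eq_mul, C_mul]; ring
  have hCu : IsUnit (C (u : k) : CoordRing k) := u.isUnit.map C
  have hCv : IsUnit (C (v : k) : CoordRing k) := v.isUnit.map C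
  simp only [pointIdeal]
  rw [← hu, ← hv, hx, hy, Ideal.span_insert, Ideal.span_insert,
    Ideal.span_singleton_mul_right_unit hCu, Ideal.span_singleton_mul_right_unit hCv]

end FatPoints

end

/-! Local charts send a form to its jets in the product of the algebras `k[s, t] / (s, t) ^ Z P`, of
total dimension `∑ (Z P + 1).choose 2`. A form of fixed bidegree goes to zero exactly when it lies
in `I_Z`, so `H_Z(i, j)` is the dimension of the image of `R_{i,j}` (`hilbertFn_eq_finrank_map`).

Let `S = R_{1,0}`, and let `ℓ ∈ S` vanish at a point of the line that is not a first coordinate of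
the support; then `ℓ` is a unit on every jet algebra. Let `F` be the product of the forms of the
first coordinates `A_u`, each to the power `l_u`: it has degree `m` and lies in `I_Z`. Since `ℓ` and
any one factor of `F` span `S`, `S ^ (i + 1) ≤ ℓ S ^ i + F S ^ (i + 1 - m)` once `m ≤ i + 1`. The
last term dies on jets, so the image in degree `(i + 1, j)` is `ℓ` times the image in degree `(i,
j)` and has the same dimension (`finrank_map_pow_succ_mul`). This gives the second claim, and
exchanging the factors gives the third.

In degree `(n, n)` with `n` large every jet is attained (`eventually_map_jetsMap_eq_top`), so the
Hilbert function has the expected value there; the two stability claims carry it to all `(i, j)` in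
the range. -/

noncomputable section

namespace FatPoints

open MvPolynomial

/-! ### Powers of a space of linear forms and the dimension of their images. -/

section LinearAlgebra

variable {k : Type*} [Field k]

theorem finrank_quotient_submoduleOf {M W : Type*} [AddCommGroup M] [Module k M] [AddCommGroup W]
    [Module k W] (V I : Submodule k M) (φ : M →ₗ[k] W) (h : ∀ f ∈ V, φ f = 0 ↔ f ∈ I) :
    Module.finrank k (V ⧸ I.submoduleOf V) = Module.finrank k (V.map φ) := by
  have hker : I.submoduleOf V = LinearMap.ker (φ.domRestrict V) := by
    ext ⟨f, hf⟩
    simp [Submodule.submoduleOf, h f hf]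
  rw [hker, (φ.domRestrict V).quotKerEquivRange.finrank_eq, LinearMap.range_domRestrict]

variable {A B : Type*} [CommRing A] [Algebra k A] [CommRing B] [Algebra k B]

theorem span_pair_pow_le (u v : A) (n : ℕ) :
    Submodule.span k {u, v} ^ n ≤ Submodule.span k {w | ∃ a b, a + b = n ∧ w = u ^ a * v ^ b} := by
  induction n with
  | zero =>
    rw [pow_zero, Submodule.one_eq_span]
    exact Submodule.span_mono (by rintro _ rfl; exact ⟨0, 0, rfl, by simp⟩)
  | succ n ih =>
    rw [pow_succ]
    refine (mul_le_mul_left ih _).trans ?_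
    rw [Submodule.span_mul_span]
    refine Submodule.span_mono ?_
    rintro _ ⟨_, ⟨a, b, rfl, rfl⟩, w, rfl | rfl, rfl⟩
    · exact ⟨a + 1, b, by ring, by ring⟩
    · exact ⟨a, b + 1, by ring, by ring⟩

theorem multiset_prod_mem_pow {S : Submodule k A} (s : Multiset A) (hs : ∀ L ∈ s, L ∈ S) :
    s.prod ∈ S ^ s.card := by
  induction s using Multiset.induction_on with
  | empty => simpa using Submodule.one_le.1 (le_refl (1 : Submodule k A))
  | cons L s ih =>
    rw [Multiset.prod_cons, Multiset.card_cons, pow_succ']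
    exact Submodule.mul_mem_mul (hs L (by simp)) (ih fun M hM => hs M (by simp [hM]))

/-- One factor `S` of the remainder is split as `a` plus the line of `L`, for each `L` in `s` in
turn. The part with `a` is absorbed because the cofactor, a partial product times a power of `S`,
stays in `S ^ N`. -/
theorem pow_succ_le_sup_span_prod {S a : Submodule k A} (s : Multiset A)
    (hs : ∀ L ∈ s, L ∈ S) (hsup : ∀ L ∈ s, S ≤ a ⊔ Submodule.span k {L}) {N q : ℕ}
    (hN : s.card + q = N + 1) :
    S ^ (N + 1) ≤ a * S ^ N ⊔ Submodule.span k {s.prod} * S ^ q := by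
  induction s using Multiset.induction_on generalizing q with
  | empty =>
    obtain rfl : q = N + 1 := by simpa using hN
    simp [← Submodule.one_eq_span]
  | cons L s ih =>
    rw [Multiset.card_cons] at hN
    refine (ih (fun M hM => hs M (by simp [hM])) (fun M hM => hsup M (by simp [hM]))
      (q := q + 1) (by omega)).trans (sup_le le_sup_left ?_)
    have hF : Submodule.span k {s.prod} * S ^ q ≤ S ^ N := by
      obtain rfl : N = s.card + q := by omega
      rw [pow_add]
      refine mul_le_mul_left ?_ _
      rw [Submodule.span_singleton_le_iff_mem]
      exact multiset_prod_mem_pow s fun M hM => hs M (by simp [hM])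
    calc Submodule.span k {s.prod} * S ^ (q + 1)
        = S * (Submodule.span k {s.prod} * S ^ q) := by rw [pow_succ]; ring
      _ ≤ (a ⊔ Submodule.span k {L}) * (Submodule.span k {s.prod} * S ^ q) :=
          mul_le_mul_left (hsup L (by simp)) _
      _ = a * (Submodule.span k {s.prod} * S ^ q) ⊔
            Submodule.span k {(L ::ₘ s).prod} * S ^ q := by
          rw [Submodule.sup_mul, ← mul_assoc (Submodule.span k {L}), Submodule.span_mul_span,
            Set.singleton_mul_singleton, Multiset.prod_cons]
      _ ≤ _ := sup_le_sup_right (mul_le_mul_right hF _) _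

/-- If `S` is spanned by `ℓ` together with any one of the elements of `s`, and `Φ` sends `ℓ` to a
unit and the product of `s` to zero, then the dimension of `Φ (S ^ N * T)` does not change
for `N ≥ card s - 1`. -/
theorem finrank_map_pow_succ_mul (Φ : A →ₐ[k] B) (S T : Submodule k A) {ℓ : A} (hℓ : ℓ ∈ S)
    (hu : IsUnit (Φ ℓ)) (s : Multiset A) (hs : ∀ L ∈ s, L ∈ S)
    (hsup : ∀ L ∈ s, S ≤ Submodule.span k {ℓ} ⊔ Submodule.span k {L}) (h0 : Φ s.prod = 0)
    {N : ℕ} (hN : s.card ≤ N + 1) :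
    Module.finrank k ((S ^ (N + 1) * T).map Φ.toLinearMap) =
      Module.finrank k ((S ^ N * T).map Φ.toLinearMap) := by
  have key : (S ^ (N + 1) * T).map Φ.toLinearMap =
      ((S ^ N * T).map Φ.toLinearMap).map (LinearMap.mulLeft k (Φ ℓ)) := by
    have hmul : ∀ p : Submodule k B,
        p.map (LinearMap.mulLeft k (Φ ℓ)) = Submodule.span k {Φ ℓ} * p := by
      intro p
      ext x
      simp [Submodule.mem_span_singleton_mul]
    rw [hmul]
    have hspan : ∀ x : A, (Submodule.span k {x}).map Φ.toLinearMap = Submodule.span k {Φ x} := by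
      intro x; simp [Submodule.map_span]
    rw [← hspan, ← Submodule.map_mul, ← mul_assoc]
    apply le_antisymm
    · have h := pow_succ_le_sup_span_prod s hs hsup (N := N) (q := N + 1 - s.card) (by omega)
      have h' := Submodule.map_mono (f := Φ.toLinearMap) (mul_le_mul_left h T)
      refine h'.trans ?_
      -- The second summand carries the factor `Φ s.prod = 0`.
      rw [Submodule.sup_mul, Submodule.map_sup, mul_assoc (Submodule.span k {s.prod}),
        Submodule.map_mul (Submodule.span k {s.prod}), hspan, h0]
      simp
    · refine Submodule.map_mono (mul_le_mul_left ?_ _)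
      rw [pow_succ']
      exact mul_le_mul_left ((Submodule.span_singleton_le_iff_mem _ _).2 hℓ) _
  rw [key]
  exact (Submodule.equivMapOfInjective _
    (fun x y hxy => hu.mul_left_cancel (by simpa using hxy)) _).finrank_eq.symm

end LinearAlgebra

variable {k : Type*} [Field k]

/-! ### Bihomogeneous forms as products of powers of linear forms. -/

section Bigraded

variable (k) in
/-- The space of forms of degree `(1, 0)`. -/
def formsX : Submodule k (CoordRing k) := Submodule.span k {X (Sum.inl 0), X (Sum.inl 1)}

variable (k) in
/-- The space of forms of degree `(0, 1)`. -/
def formsY : Submodule k (CoordRing k) := Submodule.span k {X (Sum.inr 0), X (Sum.inr 1)}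

theorem mul_mem_bigraded {a b c d : ℕ} {f g : CoordRing k} (hf : f ∈ bigraded k a b)
    (hg : g ∈ bigraded k c d) : f * g ∈ bigraded k (a + c) (b + d) :=
  IsWeightedHomogeneous.mul hf hg

theorem pow_mem_bigraded {a b : ℕ} {f : CoordRing k} (hf : f ∈ bigraded k a b) (n : ℕ) :
    f ^ n ∈ bigraded k (n * a) (n * b) := by
  have h := IsWeightedHomogeneous.pow hf n
  simpa [bigraded, mem_weightedHomogeneousSubmodule] using h

theorem one_mem_bigraded : (1 : CoordRing k) ∈ bigraded k 0 0 :=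
  isWeightedHomogeneous_one k bidegree

theorem formsX_le_bigraded : formsX k ≤ bigraded k 1 0 := by
  rw [formsX, Submodule.span_le]
  rintro _ (rfl | rfl) <;> exact isWeightedHomogeneous_X k bidegree _

theorem formsY_le_bigraded : formsY k ≤ bigraded k 0 1 := by
  rw [formsY, Submodule.span_le]
  rintro _ (rfl | rfl) <;> exact isWeightedHomogeneous_X k bidegree _

theorem formsX_pow_le_bigraded (n : ℕ) : formsX k ^ n ≤ bigraded k n 0 := by
  induction n with
  | zero => rw [pow_zero, Submodule.one_le]; exact one_mem_bigraded
  | succ n ih =>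
    rw [pow_succ, Submodule.mul_le]
    exact fun f hf g hg => mul_mem_bigraded (ih hf) (formsX_le_bigraded hg)

theorem formsY_pow_le_bigraded (n : ℕ) : formsY k ^ n ≤ bigraded k 0 n := by
  induction n with
  | zero => rw [pow_zero, Submodule.one_le]; exact one_mem_bigraded
  | succ n ih =>
    rw [pow_succ, Submodule.mul_le]
    exact fun f hf g hg => mul_mem_bigraded (ih hf) (formsY_le_bigraded hg)

/-- This makes raising the bidegree a multiplication by `formsX k` or `formsY k`, the shape needed
by `finrank_map_pow_succ_mul`. -/
theorem bigraded_eq_mul (i j : ℕ) : bigraded k i j = formsX k ^ i * formsY k ^ j := by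
  apply le_antisymm
  · intro f hf
    rw [f.as_sum]
    refine Submodule.sum_mem _ fun d hd => ?_
    have hdeg : Finsupp.weight bidegree d = (i, j) := hf (mem_support_iff.1 hd)
    have h1 : d (Sum.inl 0) + d (Sum.inl 1) = i ∧ d (Sum.inr 0) + d (Sum.inr 1) = j := by
      rw [Finsupp.weight_apply, Finsupp.sum_fintype _ _ (by simp)] at hdeg
      simpa [bidegree, Fintype.sum_sum_type, Fin.sum_univ_two, -nsmul_eq_mul] using hdeg
    rw [monomial_eq, Finsupp.prod_fintype _ _ (by simp), Fintype.prod_sum_type,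
      Fin.prod_univ_two, Fin.prod_univ_two, ← h1.1, ← h1.2, C_mul', pow_add, pow_add]
    have mX : ∀ n : Fin 2, X (Sum.inl n) ∈ formsX k := by
      intro n; fin_cases n <;> exact Submodule.subset_span (by simp)
    have mY : ∀ n : Fin 2, X (Sum.inr n) ∈ formsY k := by
      intro n; fin_cases n <;> exact Submodule.subset_span (by simp)
    exact Submodule.smul_mem _ _ (Submodule.mul_mem_mul
      (Submodule.mul_mem_mul (Submodule.pow_mem_pow _ (mX 0) _) (Submodule.pow_mem_pow _ (mX 1) _))
      (Submodule.mul_mem_mul (Submodule.pow_mem_pow _ (mY 0) _) (Submodule.pow_mem_pow _ (mY 1) _)))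
  · rw [Submodule.mul_le]
    intro f hf g hg
    simpa using mul_mem_bigraded (formsX_pow_le_bigraded i hf) (formsY_pow_le_bigraded j hg)

theorem formX_mem (u : Fin 2 → k) : formX u ∈ formsX k := by
  rw [formX, C_mul', C_mul']
  exact Submodule.sub_mem _ (Submodule.smul_mem _ _ (Submodule.subset_span (by simp)))
    (Submodule.smul_mem _ _ (Submodule.subset_span (by simp)))

theorem formY_mem (u : Fin 2 → k) : formY u ∈ formsY k := by
  rw [formY, C_mul', C_mul']
  exact Submodule.sub_mem _ (Submodule.smul_mem _ _ (Submodule.subset_span (by simp)))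
    (Submodule.smul_mem _ _ (Submodule.subset_span (by simp)))

/-- The determinant of `u` and `v`, which is the value at `v` of the linear form vanishing
at `u`. -/
def det₂ (u v : Fin 2 → k) : k := u 1 * v 0 - u 0 * v 1

theorem det₂_smul_X_inl (u v : Fin 2 → k) (n : Fin 2) :
    det₂ u v • (X (Sum.inl n) : CoordRing k) = v n • formX u - u n • formX v := by
  fin_cases n <;> simp [det₂, formX, smul_eq_C_mul] <;> ring

theorem det₂_smul_X_inr (u v : Fin 2 → k) (n : Fin 2) :
    det₂ u v • (X (Sum.inr n) : CoordRing k) = v n • formY u - u n • formY v := by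
  fin_cases n <;> simp [det₂, formY, smul_eq_C_mul] <;> ring

theorem formsX_le_span {u v : Fin 2 → k} (h : det₂ u v ≠ 0) :
    formsX k ≤ Submodule.span k {formX u, formX v} := by
  have key : ∀ n : Fin 2, X (Sum.inl n) ∈ Submodule.span k {formX u, formX v} := by
    intro n
    rw [← inv_smul_smul₀ h (X (Sum.inl n) : CoordRing k), det₂_smul_X_inl]
    exact Submodule.smul_mem _ _ (Submodule.sub_mem _
      (Submodule.smul_mem _ _ (Submodule.subset_span (by simp)))
      (Submodule.smul_mem _ _ (Submodule.subset_span (by simp))))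
  rw [formsX, Submodule.span_le]
  rintro _ (rfl | rfl) <;> exact key _

theorem formsY_le_span {u v : Fin 2 → k} (h : det₂ u v ≠ 0) :
    formsY k ≤ Submodule.span k {formY u, formY v} := by
  have key : ∀ n : Fin 2, X (Sum.inr n) ∈ Submodule.span k {formY u, formY v} := by
    intro n
    rw [← inv_smul_smul₀ h (X (Sum.inr n) : CoordRing k), det₂_smul_X_inr]
    exact Submodule.smul_mem _ _ (Submodule.sub_mem _
      (Submodule.smul_mem _ _ (Submodule.subset_span (by simp)))
      (Submodule.smul_mem _ _ (Submodule.subset_span (by simp))))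
  rw [formsY, Submodule.span_le]
  rintro _ (rfl | rfl) <;> exact key _

theorem bigraded_le_span {a a' b b' : Fin 2 → k} (ha : det₂ a a' ≠ 0) (hb : det₂ b b' ≠ 0)
    (i j : ℕ) : bigraded k i j ≤ Submodule.span k {w | ∃ p q r s, p + q = i ∧ r + s = j ∧
      w = (formX a ^ p * formX a' ^ q) * (formY b ^ r * formY b' ^ s)} := by
  rw [bigraded_eq_mul]
  refine (mul_le_mul' ((pow_le_pow_left' (formsX_le_span ha) i).trans (span_pair_pow_le _ _ _))
    ((pow_le_pow_left' (formsY_le_span hb) j).trans (span_pair_pow_le _ _ _))).trans ?_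
  rw [Submodule.span_mul_span]
  refine Submodule.span_mono ?_
  rintro _ ⟨_, ⟨p, q, h, rfl⟩, _, ⟨r, s, h', rfl⟩, rfl⟩
  exact ⟨p, q, r, s, h, h', rfl⟩

theorem exists_det₂_eq_one {a : Fin 2 → k} (ha : a ≠ 0) : ∃ a', det₂ a' a = 1 := by
  by_cases h : a 1 = 0
  · have h0 : a 0 ≠ 0 := fun h0 => ha (by ext n; fin_cases n <;> simp [h, h0])
    exact ⟨![0, (a 0)⁻¹], by simp [det₂, h0]⟩
  · exact ⟨![-(a 1)⁻¹, 0], by simp [det₂, h]⟩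

theorem det₂_rep_ne_zero {A B : P1 k} (h : A ≠ B) : det₂ A.rep B.rep ≠ 0 := by
  intro h0
  apply h
  rw [← A.mk_rep, ← B.mk_rep, Projectivization.mk_eq_mk_iff']
  have hB := B.rep_nonzero
  rw [det₂, sub_eq_zero] at h0
  by_cases hb : B.rep 0 = 0
  · have hb1 : B.rep 1 ≠ 0 := fun h1 => hB (by ext n; fin_cases n <;> simp [hb, h1])
    refine ⟨A.rep 1 / B.rep 1, ?_⟩
    ext n
    fin_cases n
    · simp only [hb, mul_zero, zero_eq_mul] at h0
      simp [hb, h0.resolve_right hb1]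
    · simp [hb1]
  · refine ⟨A.rep 0 / B.rep 0, ?_⟩
    ext n
    fin_cases n
    · simp [hb]
    · simp only [Pi.smul_apply, smul_eq_mul, Fin.mk_one]
      field_simp
      linear_combination -h0

theorem det₂_swap (u v : Fin 2 → k) : det₂ u v = -det₂ v u := by
  simp only [det₂]; ring

/-- Supplies the coordinate at which the form `ℓ` vanishes; the points `[1 : c]` are already
infinitely many. -/
theorem exists_P1_notMem [Infinite k] (s : Finset (P1 k)) : ∃ A, A ∉ s := by
  have hne : ∀ c : k, (![1, c] : Fin 2 → k) ≠ 0 := fun c h => by simpa using congrFun h 0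
  have : Infinite (P1 k) := Infinite.of_injective
    (fun c : k => Projectivization.mk k ![1, c] (hne c)) (by
      intro c d h
      obtain ⟨a, ha⟩ := (Projectivization.mk_eq_mk_iff' k _ _ _ _).1 h
      have h0 := congrFun ha 0
      have h1 := congrFun ha 1
      simp at h0 h1
      simp [← h1, h0])
  exact Infinite.exists_notMem_finset s

end Bigraded

/-! ### The jet algebra of a fat point and its dimension. -/

section Local

/-- In the quotient, `f` is a nonzero constant plus a nilpotent element. -/
theorem isUnit_mk_of_constantCoeff_ne_zero {σ : Type*} {f : MvPolynomial σ k}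
    (hf : constantCoeff f ≠ 0) (m : ℕ) :
    IsUnit (Ideal.Quotient.mk (idealOfVars σ k ^ m) f) := by
  have hmem : f - C (constantCoeff f) ∈ idealOfVars σ k := by
    rw [← pow_one (idealOfVars σ k), mem_pow_idealOfVars_iff']
    intro x hx
    obtain rfl : x = 0 := by simpa [Finsupp.degree_eq_zero_iff] using hx
    simp [constantCoeff_eq]
  have hnil : IsNilpotent (Ideal.Quotient.mk (idealOfVars σ k ^ m) (f - C (constantCoeff f))) :=
    ⟨m, by rw [← map_pow, Ideal.Quotient.eq_zero_iff_mem]; exact Ideal.pow_mem_pow hmem m⟩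
  have hunit : IsUnit (Ideal.Quotient.mk (idealOfVars σ k ^ m) (C (constantCoeff f))) :=
    (hf.isUnit.map C).map _
  have h := hnil.isUnit_add_left_of_commute hunit (Commute.all _ _)
  rwa [← map_add, add_sub_cancel] at h

/-- The exponents of the monomials of degree less than `m` in two variables. -/
def lowExponent {m : ℕ} (x : Σ n : Fin m, Fin (n + 1)) : Fin 2 →₀ ℕ :=
  Finsupp.equivFunOnFinite.symm ![x.2, x.1 - x.2]

theorem lowExponent_injective {m : ℕ} : Function.Injective (lowExponent (m := m)) := by
  rintro ⟨⟨n, hn⟩, ⟨a, ha⟩⟩ ⟨⟨n', hn'⟩, ⟨a', ha'⟩⟩ h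
  have h0 := DFunLike.congr_fun h 0
  have h1 := DFunLike.congr_fun h 1
  simp [lowExponent] at h0 h1 ha ha'
  obtain rfl : n = n' := by omega
  subst h0
  rfl

theorem exists_lowExponent_iff {m : ℕ} (d : Fin 2 →₀ ℕ) :
    (∃ x : Σ n : Fin m, Fin (n + 1), lowExponent x = d) ↔ d.degree < m := by
  rw [Finsupp.degree_eq_sum, Fin.sum_univ_two]
  constructor
  · rintro ⟨⟨⟨n, hn⟩, ⟨a, ha⟩⟩, rfl⟩
    simp [lowExponent] at ha ⊢
    omega
  · intro h
    refine ⟨⟨⟨d 0 + d 1, h⟩, ⟨d 0, by simp⟩⟩, ?_⟩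
    ext n
    fin_cases n <;> simp [lowExponent]

theorem card_lowExponent (m : ℕ) :
    Fintype.card (Σ n : Fin m, Fin (n + 1)) = (m + 1).choose 2 := by
  simp only [Fintype.card_sigma, Fintype.card_fin]
  rw [Fin.sum_univ_eq_sum_range (fun n => n + 1) m]
  induction m with
  | zero => rfl
  | succ m ih => rw [Finset.sum_range_succ, ih, Nat.choose_succ_succ' (m + 1) 1]; simp; ring

variable (k) in
/-- The coefficients of degree less than `m`. -/
def lowCoeffs (m : ℕ) : MvPolynomial (Fin 2) k →ₗ[k] ((Σ n : Fin m, Fin (n + 1)) → k) :=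
  LinearMap.pi fun x => lcoeff k (lowExponent x)

theorem lowCoeffs_surjective (m : ℕ) : Function.Surjective (lowCoeffs k m) := by
  classical
  intro g
  refine ⟨∑ x, monomial (lowExponent x) (g x), ?_⟩
  ext y
  simp [lowCoeffs, coeff_monomial, lowExponent_injective.eq_iff]

theorem ker_lowCoeffs (m : ℕ) : LinearMap.ker (lowCoeffs k m) =
    (idealOfVars (Fin 2) k ^ m).restrictScalars k := by
  ext f
  rw [Submodule.restrictScalars_mem, mem_pow_idealOfVars_iff', LinearMap.mem_ker]
  simp only [← exists_lowExponent_iff, forall_exists_index, forall_apply_eq_imp_iff, funext_iff]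
  simp [lowCoeffs]

/-- The quotient of `k[s, t]` by the `m`-th power of the ideal of the origin. -/
abbrev Jets (k : Type*) [Field k] (m : ℕ) := MvPolynomial (Fin 2) k ⧸ (idealOfVars (Fin 2) k ^ m)

variable (k) in
/-- `Jets k m` in terms of the coefficients of degree less than `m`. -/
def jetsEquiv (m : ℕ) : Jets k m ≃ₗ[k] ((Σ n : Fin m, Fin (n + 1)) → k) :=
  (Submodule.quotEquivOfEq _ _ (ker_lowCoeffs m).symm).trans
    ((lowCoeffs k m).quotKerEquivOfSurjective (lowCoeffs_surjective m))

instance finite_jets (m : ℕ) : Module.Finite k (Jets k m) := Module.Finite.equiv (jetsEquiv k m).symm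

theorem finrank_jets (m : ℕ) : Module.finrank k (Jets k m) = (m + 1).choose 2 := by
  rw [(jetsEquiv k m).finrank_eq, Module.finrank_fintype_fun_eq_card, card_lowExponent]

end Local

/-! ### Affine charts, dehomogenization and homogenization. -/

section Chart

/-- A vector completing the representative of `A` to a unimodular basis. -/
def complement (A : P1 k) : Fin 2 → k := (exists_det₂_eq_one A.rep_nonzero).choose

theorem det₂_complement (A : P1 k) : det₂ (complement A) A.rep = 1 :=
  (exists_det₂_eq_one A.rep_nonzero).choose_spec

/-- The affine chart of `ℙ¹ × ℙ¹` centred at `P`: local coordinates are `X 0 = s` and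
`X 1 = t`. -/
def chart (P : P1 k × P1 k) : CoordRing k →ₐ[k] MvPolynomial (Fin 2) k :=
  aeval (Sum.elim (fun n => C (P.1.rep n) - C (complement P.1 n) * X 0)
    (fun n => C (P.2.rep n) - C (complement P.2 n) * X 1))

/-- The chart evaluates a form at the moving vector `rep - s • complement`, and `det₂` is linear in
its second argument. -/
theorem chart_formX (P : P1 k × P1 k) (u : Fin 2 → k) :
    chart P (formX u) = C (det₂ u P.1.rep) - C (det₂ u (complement P.1)) * X 0 := by
  simp only [chart, formX, map_sub, map_mul, aeval_X, algHom_C, Sum.elim_inl, det₂,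
    algebraMap_eq]
  ring

theorem chart_formY (P : P1 k × P1 k) (u : Fin 2 → k) :
    chart P (formY u) = C (det₂ u P.2.rep) - C (det₂ u (complement P.2)) * X 1 := by
  simp only [chart, formY, map_sub, map_mul, aeval_X, algHom_C, Sum.elim_inr, det₂,
    algebraMap_eq]
  ring

theorem det₂_self (u : Fin 2 → k) : det₂ u u = 0 := by
  simp only [det₂]; ring

theorem det₂_rep_complement (A : P1 k) : det₂ A.rep (complement A) = -1 := by
  rw [det₂_swap, det₂_complement]

theorem chart_formX_rep (P : P1 k × P1 k) : chart P (formX P.1.rep) = X 0 := by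
  simp [chart_formX, det₂_self, det₂_rep_complement]

theorem chart_formX_complement (P : P1 k × P1 k) : chart P (formX (complement P.1)) = 1 := by
  simp [chart_formX, det₂_self, det₂_complement]

theorem chart_formY_rep (P : P1 k × P1 k) : chart P (formY P.2.rep) = X 1 := by
  simp [chart_formY, det₂_self, det₂_rep_complement]

theorem chart_formY_complement (P : P1 k × P1 k) : chart P (formY (complement P.2)) = 1 := by
  simp [chart_formY, det₂_self, det₂_complement]

theorem constantCoeff_chart_formX (P : P1 k × P1 k) (u : Fin 2 → k) :
    constantCoeff (chart P (formX u)) = det₂ u P.1.rep := by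
  simp [chart_formX]

theorem constantCoeff_chart_formY (P : P1 k × P1 k) (u : Fin 2 → k) :
    constantCoeff (chart P (formY u)) = det₂ u P.2.rep := by
  simp [chart_formY]

/-- The form of degree `(i, j)` whose image in the chart at `P` is the monomial with exponent `d`,
provided that `d 0 ≤ i` and `d 1 ≤ j`. -/
def homogMonomial (P : P1 k × P1 k) (i j : ℕ) (d : Fin 2 →₀ ℕ) : CoordRing k :=
  (formX P.1.rep ^ d 0 * formX (complement P.1) ^ (i - d 0)) *
    (formY P.2.rep ^ d 1 * formY (complement P.2) ^ (j - d 1))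

theorem chart_homogMonomial (P : P1 k × P1 k) (i j : ℕ) (d : Fin 2 →₀ ℕ) :
    chart P (homogMonomial P i j d) = monomial d 1 := by
  simp [homogMonomial, chart_formX_rep, chart_formX_complement, chart_formY_rep,
    chart_formY_complement, monomial_eq, Finsupp.prod_fintype, Fin.prod_univ_two]

theorem homogMonomial_mem_bigraded (P : P1 k × P1 k) {i j : ℕ} {d : Fin 2 →₀ ℕ} (hi : d 0 ≤ i)
    (hj : d 1 ≤ j) : homogMonomial P i j d ∈ bigraded k i j := by
  rw [bigraded_eq_mul]
  refine Submodule.mul_mem_mul ?_ ?_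
  -- The first rewrite replaces every `i`; the last one restores the exponent `i - d 0` on the left.
  · rw [← Nat.add_sub_cancel' hi, pow_add, Nat.add_sub_cancel' hi]
    exact Submodule.mul_mem_mul (Submodule.pow_mem_pow _ (formX_mem _) _)
      (Submodule.pow_mem_pow _ (formX_mem _) _)
  · rw [← Nat.add_sub_cancel' hj, pow_add, Nat.add_sub_cancel' hj]
    exact Submodule.mul_mem_mul (Submodule.pow_mem_pow _ (formY_mem _) _)
      (Submodule.pow_mem_pow _ (formY_mem _) _)

theorem homogMonomial_mem_pointIdeal_pow (P : P1 k × P1 k) (i j : ℕ) {d : Fin 2 →₀ ℕ} {m : ℕ}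
    (hd : m ≤ d.degree) : homogMonomial P i j d ∈ pointIdeal P ^ m := by
  refine Ideal.pow_le_pow_right hd ?_
  rw [Finsupp.degree_eq_sum, Fin.sum_univ_two, pow_add, homogMonomial]
  exact Ideal.mul_mem_mul
    (Ideal.mul_mem_right _ _ (Ideal.pow_mem_pow (Ideal.subset_span (by simp)) _))
    (Ideal.mul_mem_right _ _ (Ideal.pow_mem_pow (Ideal.subset_span (by simp)) _))

/-- Homogenization to degree `(i, j)` with respect to the chart at `P`. -/
def homogenize (P : P1 k × P1 k) (i j : ℕ) : MvPolynomial (Fin 2) k →ₗ[k] CoordRing k :=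
  (basisMonomials (Fin 2) k).constr k (homogMonomial P i j)

theorem homogenize_monomial (P : P1 k × P1 k) (i j : ℕ) (d : Fin 2 →₀ ℕ) (c : k) :
    homogenize P i j (monomial d c) = c • homogMonomial P i j d := by
  have h := (basisMonomials (Fin 2) k).constr_basis k (homogMonomial P i j) d
  rw [coe_basisMonomials] at h
  rw [← mul_one c, ← smul_eq_mul, ← smul_monomial, map_smul, smul_eq_mul, mul_one]
  exact congrArg _ h

/-- By linearity it is enough to treat products of powers of the four forms adapted to `P`, which
span `R_{i,j}` and are themselves of the form `homogMonomial`. -/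
theorem homogenize_chart (P : P1 k × P1 k) {i j : ℕ} {f : CoordRing k} (hf : f ∈ bigraded k i j) :
    homogenize P i j (chart P f) = f := by
  have h1 : det₂ P.1.rep (complement P.1) ≠ 0 := by simp [det₂_rep_complement]
  have h2 : det₂ P.2.rep (complement P.2) ≠ 0 := by simp [det₂_rep_complement]
  refine LinearMap.eqOn_span (f := homogenize P i j ∘ₗ (chart P).toLinearMap)
    (g := LinearMap.id) ?_ (bigraded_le_span h1 h2 i j hf)
  rintro _ ⟨p, q, r, s, rfl, rfl, rfl⟩
  have hw : (formX P.1.rep ^ p * formX (complement P.1) ^ q) *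
      (formY P.2.rep ^ r * formY (complement P.2) ^ s) =
      homogMonomial P (p + q) (r + s) (Finsupp.equivFunOnFinite.symm ![p, r]) := by
    simp [homogMonomial]
  simp only [hw, LinearMap.comp_apply, AlgHom.toLinearMap_apply, chart_homogMonomial,
    homogenize_monomial, one_smul, LinearMap.id_apply]

theorem homogenize_mem (P : P1 k × P1 k) (i j : ℕ) {m : ℕ} {g : MvPolynomial (Fin 2) k}
    (hg : g ∈ idealOfVars (Fin 2) k ^ m) : homogenize P i j g ∈ pointIdeal P ^ m := by
  rw [mem_pow_idealOfVars_iff] at hg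
  rw [g.as_sum, map_sum]
  refine Ideal.sum_mem _ fun d hd => ?_
  rw [homogenize_monomial, smul_eq_C_mul]
  exact Ideal.mul_mem_left _ _ (homogMonomial_mem_pointIdeal_pow P i j (hg d hd))

theorem map_chart_pointIdeal_le (P : P1 k × P1 k) :
    (pointIdeal P).map (chart P) ≤ idealOfVars (Fin 2) k := by
  rw [pointIdeal, Ideal.map_span, Ideal.span_le]
  rintro _ ⟨_, rfl | rfl, rfl⟩
  · rw [chart_formX_rep]; exact Ideal.subset_span ⟨0, rfl⟩
  · rw [chart_formY_rep]; exact Ideal.subset_span ⟨1, rfl⟩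

theorem chart_mem_of_mem_pointIdeal_pow (P : P1 k × P1 k) {m : ℕ} {f : CoordRing k}
    (hf : f ∈ pointIdeal P ^ m) : chart P f ∈ idealOfVars (Fin 2) k ^ m := by
  have h := Ideal.mem_map_of_mem (chart P) hf
  rw [Ideal.map_pow] at h
  exact Ideal.pow_right_mono (map_chart_pointIdeal_le P) m h

/-- Bihomogeneity is essential: `1 - formX (complement P.1)` vanishes in the chart. For a form of
known bidegree, homogenizing recovers `f` and takes monomials of degree at least `m` into
`pointIdeal P ^ m`. -/
theorem chart_mem_iff (P : P1 k × P1 k) {i j m : ℕ} {f : CoordRing k} (hf : f ∈ bigraded k i j) :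
    chart P f ∈ idealOfVars (Fin 2) k ^ m ↔ f ∈ pointIdeal P ^ m :=
  ⟨fun h => homogenize_chart P hf ▸ homogenize_mem P i j h, chart_mem_of_mem_pointIdeal_pow P⟩

/-- Monomials of degree less than `m` fit into bidegree `(i, j)` and lift exactly; the others vanish
as jets. -/
theorem exists_bigraded_chart_sub_mem (P : P1 k × P1 k) {i j m : ℕ} (hi : m ≤ i) (hj : m ≤ j)
    (g : MvPolynomial (Fin 2) k) :
    ∃ f ∈ bigraded k i j, chart P f - g ∈ idealOfVars (Fin 2) k ^ m := by
  induction g using MvPolynomial.induction_on' with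
  | monomial d c =>
    by_cases hd : d.degree < m
    · rw [Finsupp.degree_eq_sum, Fin.sum_univ_two] at hd
      refine ⟨c • homogMonomial P i j d, Submodule.smul_mem _ _
        (homogMonomial_mem_bigraded P (by omega) (by omega)), ?_⟩
      rw [map_smul, chart_homogMonomial, smul_monomial, smul_eq_mul, mul_one, sub_self]
      exact Ideal.zero_mem _
    · refine ⟨0, Submodule.zero_mem _, ?_⟩
      rw [map_zero, zero_sub, neg_mem_iff, mem_pow_idealOfVars_iff]
      intro x hx
      obtain rfl : x = d := by simpa using support_monomial_subset hx
      omega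
  | add p q hp hq =>
    obtain ⟨f, hf, hf'⟩ := hp
    obtain ⟨g, hg, hg'⟩ := hq
    refine ⟨f + g, Submodule.add_mem _ hf hg, ?_⟩
    rw [map_add, add_sub_add_comm]
    exact Ideal.add_mem _ hf' hg'

end Chart

/-! ### Restriction to the scheme, and its surjectivity in large degree. -/

section Evaluation

/-- The restriction of forms to the fat point scheme `Z`. -/
def jetsMap (Z : FatPointScheme k) : CoordRing k →ₐ[k] ((P : Z.support) → Jets k (Z P)) :=
  AlgHom.pi fun P => (Ideal.Quotient.mkₐ k _).comp (chart P.1)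

theorem jetsMap_apply (Z : FatPointScheme k) (f : CoordRing k) (P : Z.support) :
    jetsMap Z f P = Ideal.Quotient.mk _ (chart P.1 f) := rfl

theorem mem_ideal_iff {Z : FatPointScheme k} {f : CoordRing k} :
    f ∈ ideal Z ↔ ∀ P ∈ Z.support, f ∈ pointIdeal P ^ Z P := by
  simp only [ideal, Submodule.mem_iInf]

theorem jetsMap_eq_zero_iff (Z : FatPointScheme k) {i j : ℕ} {f : CoordRing k}
    (hf : f ∈ bigraded k i j) : jetsMap Z f = 0 ↔ f ∈ ideal Z := by
  simp only [funext_iff, jetsMap_apply, Pi.zero_apply, Ideal.Quotient.eq_zero_iff_mem,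
    chart_mem_iff _ hf, mem_ideal_iff, Subtype.forall]

theorem jetsMap_eq_zero_of_mem {Z : FatPointScheme k} {f : CoordRing k} (hf : f ∈ ideal Z) :
    jetsMap Z f = 0 := by
  ext P
  rw [jetsMap_apply, Pi.zero_apply, Ideal.Quotient.eq_zero_iff_mem]
  exact chart_mem_of_mem_pointIdeal_pow _ (mem_ideal_iff.1 hf P P.2)

theorem hilbertFn_eq_finrank_map (Z : FatPointScheme k) (i j : ℕ) :
    hilbertFn Z i j = Module.finrank k ((bigraded k i j).map (jetsMap Z).toLinearMap) :=
  finrank_quotient_submoduleOf _ _ _ fun _ hf => jetsMap_eq_zero_iff Z hf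

theorem finrank_pi_jets (Z : FatPointScheme k) :
    Module.finrank k ((P : Z.support) → Jets k (Z P)) = ∑ P ∈ Z.support, (Z P + 1).choose 2 := by
  rw [Module.finrank_pi_fintype]
  simp only [finrank_jets]
  exact Finset.sum_coe_sort Z.support fun P => (Z P + 1).choose 2

/-- A form vanishing to prescribed orders at finitely many points, but not at another point `P`. -/
theorem exists_separating_form (P : P1 k × P1 k) (s : Finset (P1 k × P1 k)) (hP : P ∉ s)
    (m : P1 k × P1 k → ℕ) : ∃ c d, ∃ e ∈ bigraded k c d, constantCoeff (chart P e) ≠ 0 ∧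
      ∀ Q ∈ s, e ∈ pointIdeal Q ^ m Q := by
  classical
  induction s using Finset.induction_on with
  | empty => exact ⟨0, 0, 1, one_mem_bigraded, by simp, by simp⟩
  | insert Q s _ ih =>
    rw [Finset.mem_insert, not_or] at hP
    obtain ⟨c, d, e, he, he0, hes⟩ := ih hP.2
    have hg : ∃ c' d', ∃ g ∈ bigraded k c' d', constantCoeff (chart P g) ≠ 0 ∧
        g ∈ pointIdeal Q := by
      by_cases h : Q.1 = P.1
      · have h' : Q.2 ≠ P.2 := fun h' => hP.1 (Prod.ext h h').symm
        refine ⟨0, 1, formY Q.2.rep, formsY_le_bigraded (formY_mem _), ?_,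
          Ideal.subset_span (by simp)⟩
        rw [constantCoeff_chart_formY]
        exact det₂_rep_ne_zero h'
      · refine ⟨1, 0, formX Q.1.rep, formsX_le_bigraded (formX_mem _), ?_,
          Ideal.subset_span (by simp)⟩
        rw [constantCoeff_chart_formX]
        exact det₂_rep_ne_zero h
    obtain ⟨c', d', g, hg, hg0, hgQ⟩ := hg
    refine ⟨_, _, g ^ m Q * e, mul_mem_bigraded (pow_mem_bigraded hg (m Q)) he, ?_, ?_⟩
    · simp [hg0, he0]
    · intro Q' hQ'
      rcases Finset.mem_insert.1 hQ' with rfl | hQ'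
      · exact Ideal.mul_mem_right _ _ (Ideal.pow_mem_pow hgQ _)
      · exact Ideal.mul_mem_left _ _ (hes Q' hQ')

/-- A separating form `e` at `P` is a unit in the jets at `P` and zero in the jets at the other
points. Multiplying it by forms that realize all jets at `P` fills that factor of the product. -/
theorem eventually_map_jetsMap_eq_top (Z : FatPointScheme k) :
    ∀ᶠ n in Filter.atTop, (bigraded k n n).map (jetsMap Z).toLinearMap = ⊤ := by
  classical
  have key : ∀ P : Z.support, ∀ᶠ n in Filter.atTop, ∀ t : Jets k (Z P),
      Pi.single P t ∈ (bigraded k n n).map (jetsMap Z).toLinearMap := by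
    intro P
    obtain ⟨c, d, e, he, he0, hes⟩ := exists_separating_form P.1 (Z.support.erase P.1) (by simp) Z
    filter_upwards [Filter.eventually_ge_atTop (c + d + Z P)] with n hn t
    obtain ⟨u, hu⟩ := isUnit_mk_of_constantCoeff_ne_zero he0 (Z P)
    -- The target jet is divided in advance by the class of `e`, so that `e * f` restricts to `t`.
    obtain ⟨g, hg⟩ := Ideal.Quotient.mk_surjective ((↑u⁻¹ : Jets k (Z P)) * t)
    obtain ⟨f, hf, hfg⟩ := exists_bigraded_chart_sub_mem P.1 (i := n - c) (j := n - d)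
      (m := Z P) (by omega) (by omega) g
    refine ⟨e * f, ?_, ?_⟩
    · have h := mul_mem_bigraded he hf
      rwa [Nat.add_sub_cancel' (by omega), Nat.add_sub_cancel' (by omega)] at h
    · rw [← Ideal.Quotient.eq] at hfg
      ext Q
      rw [AlgHom.toLinearMap_apply, jetsMap_apply]
      by_cases hQ : Q = P
      · subst hQ
        rw [Pi.single_eq_same, map_mul, map_mul, hfg, hg, ← hu, Units.mul_inv_cancel_left]
      · rw [Pi.single_eq_of_ne hQ, Ideal.Quotient.eq_zero_iff_mem, map_mul]
        refine Ideal.mul_mem_right _ _ (chart_mem_of_mem_pointIdeal_pow _ (hes _ ?_))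
        exact Finset.mem_erase.2 ⟨fun h => hQ (Subtype.ext h), Q.2⟩
  filter_upwards [Filter.eventually_all.2 key] with n hn
  rw [eq_top_iff]
  rintro v -
  rw [← Finset.univ_sum_single v]
  exact Submodule.sum_mem _ fun P _ => hn P (v P)

theorem eventually_hilbertFn_eq (Z : FatPointScheme k) :
    ∀ᶠ n in Filter.atTop, hilbertFn Z n n = ∑ P ∈ Z.support, (Z P + 1).choose 2 := by
  filter_upwards [eventually_map_jetsMap_eq_top Z] with n hn
  rw [hilbertFn_eq_finrank_map, hn, finrank_top, finrank_pi_jets]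

end Evaluation

/-! ### Stability in each direction and the resulting values. -/

section Stabilization

theorem le_maxMult₁ (Z : FatPointScheme k) {P : P1 k × P1 k} (hP : P ∈ Z.support) :
    Z P ≤ maxMult₁ Z P.1 :=
  Finset.le_sup (f := fun P => Z P) (by simpa using hP)

theorem le_maxMult₂ (Z : FatPointScheme k) {P : P1 k × P1 k} (hP : P ∈ Z.support) :
    Z P ≤ maxMult₂ Z P.2 :=
  Finset.le_sup (f := fun P => Z P) (by simpa using hP)

variable [Infinite k]

theorem hilbertFn_succ_left (Z : FatPointScheme k) {i j : ℕ} (hi : sumMax₁ Z ≤ i + 1) :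
    hilbertFn Z (i + 1) j = hilbertFn Z i j := by
  classical
  obtain ⟨D, hD⟩ := exists_P1_notMem (Z.support.image Prod.fst)
  set s : Multiset (CoordRing k) := ∑ A ∈ Z.support.image Prod.fst,
    Multiset.replicate (maxMult₁ Z A) (formX A.rep) with hs
  have hmem : ∀ L ∈ s, ∃ A ∈ Z.support.image Prod.fst, L = formX A.rep := by
    intro L hL
    obtain ⟨A, hA, hL⟩ := Multiset.mem_sum.1 hL
    exact ⟨A, hA, Multiset.eq_of_mem_replicate hL⟩
  have hcard : s.card = sumMax₁ Z := by
    rw [hs, Multiset.card_sum, sumMax₁]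
    simp
  have hprod : s.prod ∈ ideal Z := by
    rw [mem_ideal_iff]
    intro P hP
    rw [hs, Multiset.prod_sum]
    simp only [Multiset.prod_replicate]
    -- The factor attached to the first coordinate of `P` alone lies in the required power, its
    -- exponent being a maximum over that fibre.
    refine Ideal.mem_of_dvd _ (Finset.dvd_prod_of_mem _ (Finset.mem_image_of_mem Prod.fst hP)) ?_
    exact Ideal.pow_le_pow_right (le_maxMult₁ Z hP) (Ideal.pow_mem_pow
      (Ideal.subset_span (by simp)) _)
  rw [hilbertFn_eq_finrank_map, hilbertFn_eq_finrank_map, bigraded_eq_mul, bigraded_eq_mul]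
  refine finrank_map_pow_succ_mul (jetsMap Z) (formsX k) (formsY k ^ j) (formX_mem D.rep) ?_ s
    ?_ ?_ (jetsMap_eq_zero_of_mem hprod) (hcard ▸ hi)
  -- `formX D.rep` has nonzero constant term in every chart, since `D` is no first coordinate of the
  -- support.
  · rw [Pi.isUnit_iff]
    intro P
    rw [jetsMap_apply]
    refine isUnit_mk_of_constantCoeff_ne_zero ?_ _
    rw [constantCoeff_chart_formX]
    exact det₂_rep_ne_zero fun h => hD (h ▸ Finset.mem_image_of_mem Prod.fst P.2)
  · intro L hL
    obtain ⟨A, -, rfl⟩ := hmem L hL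
    exact formX_mem _
  · intro L hL
    obtain ⟨A, hA, rfl⟩ := hmem L hL
    rw [← Submodule.span_insert]
    exact formsX_le_span (det₂_rep_ne_zero fun h => hD (h ▸ hA))

theorem hilbertFn_succ_right (Z : FatPointScheme k) {i j : ℕ} (hj : sumMax₂ Z ≤ j + 1) :
    hilbertFn Z i (j + 1) = hilbertFn Z i j := by
  classical
  obtain ⟨D, hD⟩ := exists_P1_notMem (Z.support.image Prod.snd)
  set s : Multiset (CoordRing k) := ∑ B ∈ Z.support.image Prod.snd,
    Multiset.replicate (maxMult₂ Z B) (formY B.rep) with hs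
  have hmem : ∀ L ∈ s, ∃ B ∈ Z.support.image Prod.snd, L = formY B.rep := by
    intro L hL
    obtain ⟨B, hB, hL⟩ := Multiset.mem_sum.1 hL
    exact ⟨B, hB, Multiset.eq_of_mem_replicate hL⟩
  have hcard : s.card = sumMax₂ Z := by
    rw [hs, Multiset.card_sum, sumMax₂]
    simp
  have hprod : s.prod ∈ ideal Z := by
    rw [mem_ideal_iff]
    intro P hP
    rw [hs, Multiset.prod_sum]
    simp only [Multiset.prod_replicate]
    refine Ideal.mem_of_dvd _ (Finset.dvd_prod_of_mem _ (Finset.mem_image_of_mem Prod.snd hP)) ?_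
    exact Ideal.pow_le_pow_right (le_maxMult₂ Z hP) (Ideal.pow_mem_pow
      (Ideal.subset_span (by simp)) _)
  rw [hilbertFn_eq_finrank_map, hilbertFn_eq_finrank_map, bigraded_eq_mul, bigraded_eq_mul,
    mul_comm, mul_comm (formsX k ^ i)]
  refine finrank_map_pow_succ_mul (jetsMap Z) (formsY k) (formsX k ^ i) (formY_mem D.rep) ?_ s
    ?_ ?_ (jetsMap_eq_zero_of_mem hprod) (hcard ▸ hj)
  · rw [Pi.isUnit_iff]
    intro P
    rw [jetsMap_apply]
    refine isUnit_mk_of_constantCoeff_ne_zero ?_ _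
    rw [constantCoeff_chart_formY]
    exact det₂_rep_ne_zero fun h => hD (h ▸ Finset.mem_image_of_mem Prod.snd P.2)
  · intro L hL
    obtain ⟨B, -, rfl⟩ := hmem L hL
    exact formY_mem _
  · intro L hL
    obtain ⟨B, hB, rfl⟩ := hmem L hL
    rw [← Submodule.span_insert]
    exact formsY_le_span (det₂_rep_ne_zero fun h => hD (h ▸ hB))

/-- Truncated subtraction is harmless: `sumMax₁ Z - 1 ≤ i` gives `sumMax₁ Z ≤ i + 1` also for empty
support. -/
theorem hilbertFn_eq_of_le_left (Z : FatPointScheme k) {i j : ℕ} (hi : sumMax₁ Z - 1 ≤ i) :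
    hilbertFn Z i j = hilbertFn Z (sumMax₁ Z - 1) j := by
  induction i, hi using Nat.le_induction with
  | base => rfl
  | succ i hi ih => rw [hilbertFn_succ_left Z (by omega), ih]

theorem hilbertFn_eq_of_le_right (Z : FatPointScheme k) {i j : ℕ} (hj : sumMax₂ Z - 1 ≤ j) :
    hilbertFn Z i j = hilbertFn Z i (sumMax₂ Z - 1) := by
  induction j, hj using Nat.le_induction with
  | base => rfl
  | succ j hj ih => rw [hilbertFn_succ_right Z (by omega), ih]

theorem hilbertFn_eq_sum_choose (Z : FatPointScheme k) {i j : ℕ} (hi : sumMax₁ Z - 1 ≤ i)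
    (hj : sumMax₂ Z - 1 ≤ j) : hilbertFn Z i j = ∑ P ∈ Z.support, (Z P + 1).choose 2 := by
  obtain ⟨n, hn, hn₁, hn₂⟩ := ((eventually_hilbertFn_eq Z).and
    ((Filter.eventually_ge_atTop (sumMax₁ Z - 1)).and
      (Filter.eventually_ge_atTop (sumMax₂ Z - 1)))).exists
  -- Both `(i, j)` and `(n, n)` reduce to the corner `(sumMax₁ Z - 1, sumMax₂ Z - 1)`.
  rw [← hn, hilbertFn_eq_of_le_left Z hi, hilbertFn_eq_of_le_right Z hj,
    hilbertFn_eq_of_le_left Z hn₁, hilbertFn_eq_of_le_right Z hn₂]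

end Stabilization

end FatPoints

end

theorem corollary3p4 {k : Type*} [Field k] [IsAlgClosed k] (Z : FatPoints.FatPointScheme k) :
    (∀ i j : ℕ, FatPoints.sumMax₁ Z - 1 ≤ i → FatPoints.sumMax₂ Z - 1 ≤ j →
      FatPoints.hilbertFn Z i j = ∑ P ∈ Z.support, (Z P + 1).choose 2) ∧
    (∀ i j : ℕ, FatPoints.sumMax₁ Z - 1 ≤ i →
      FatPoints.hilbertFn Z i j = FatPoints.hilbertFn Z (FatPoints.sumMax₁ Z - 1) j) ∧
    (∀ i j : ℕ, FatPoints.sumMax₂ Z - 1 ≤ j →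
      FatPoints.hilbertFn Z i j = FatPoints.hilbertFn Z i (FatPoints.sumMax₂ Z - 1)) := by
  exact ⟨fun _ _ => FatPoints.hilbertFn_eq_sum_choose Z,
    fun _ _ => FatPoints.hilbertFn_eq_of_le_left Z,
    fun _ _ => FatPoints.hilbertFn_eq_of_le_right Z⟩
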